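/- Let $(\Omega,\mathcal A,P)$ be a probability space. Let $g:[0,1]\to[0,1]$ be a distortion function, that is, $g$ is increasing (in the wide sense) and right-continuous with $\lim_{u\nearrow 1}g(u)=g(1)=1$, and let $\mu_g$ be the Borel probability measure on $[0,1]$ with $\mu_g([0,u])=g(u)$ for $u\in[0,1]$; write $\int_0^1 f\,\mathrm dg=\int_{[0,1]} f\,\mathrm d\mu_g$. Let $\phi:[0,\infty)\to[0,\infty)$ be a Young function, that is, $\phi$ is convex with $\phi(0)=0$ and $\lim_{t\to\infty}\phi(t)=\infty$; put $\phi(\infty)=\infty$. For a real random variable $X$ on $\Omega$ with distribution function $F_X$ let $F_X^{-1}(u)=\inf\{x\in\mathbb R: F_X(x)\ge u\}\in[-\infty,\infty]$, $u\in[0,1]$. Let $L_g^\phi$ be the set of all real random variables $X$ on $\Omega$ (identified if they coincide almost surely) for which there is some $a>0$ such that \[ \int_0^1 \phi\Big(\frac{|F_X^{-1}(1-u)|}{a}\Big)\,\mathrm dg(u)<\infty . \] Suppose that $g$ is concave and that at least one of the following holds: (i) $g$ is constant on some interval $[u_0,1]$ with $u_0\in[0,1)$; (ii) $g'(1)>0$,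 where $g'(1)$ is the left derivative of $g$ at $1$. Then $L_g^\phi$ is a convex cone: it contains $0$, and $X+Y\in L_g^\phi$ and $\lambda X\in L_g^\phi$ for all $X,Y\in L_g^\phi$ and all $\lambda\ge 0$. -/

import Mathlib

open MeasureTheory ProbabilityTheory Set Filter Topology
open scoped ENNReal

/-- A distortion function `g : [0,1] → [0,1]`: increasing, right-continuous, with
`lim_{u ↗ 1} g(u) = g(1) = 1`. Values of `g` outside `[0,1]` are irrelevant. -/
structure IsDistortionFunction (g : ℝ → ℝ) : Prop where
  mapsTo : MapsTo g (Icc 0 1) (Icc 0 1)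
  monotoneOn : MonotoneOn g (Icc 0 1)
  right_continuous : ∀ u ∈ Ico (0 : ℝ) 1, ContinuousWithinAt g (Icc u 1) u
  tendsto_one : Tendsto g (𝓝[<] 1) (𝓝 1)
  map_one : g 1 = 1

/-- A Young function `φ : [0,∞) → [0,∞)`: convex, `φ(0) = 0`, `φ(t) → ∞` as `t → ∞`.
Values of `φ` on `(-∞,0)` are irrelevant. -/
structure IsYoungFunction (φ : ℝ → ℝ) : Prop where
  nonneg : ∀ t, 0 ≤ t → 0 ≤ φ t
  convexOn : ConvexOn ℝ (Ici 0) φ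
  map_zero : φ 0 = 0
  tendsto_atTop : Tendsto φ atTop atTop

namespace IsDistortionFunction

/-- The extension of a distortion function to `ℝ`, by `0` on `(-∞,0)` (so that `g(0-) = 0`)
and by `g(1) = 1` on `(1,∞)`, as a Stieltjes function. -/
noncomputable def stieltjes {g : ℝ → ℝ} (hg : IsDistortionFunction g) : StieltjesFunction ℝ where
  toFun x := if x < 0 then 0 else g (min x 1)
  mono' := by
    intro x y hxy
    by_cases hx : x < 0
    · by_cases hy : y < 0
      · simp [hx, hy]
      · have hy' : 0 ≤ y := not_lt.mp hy
        simpa [hx, hy] using (hg.mapsTo (x := min y 1) ⟨by positivity, min_le_right _ _⟩).1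
    · have hx' : 0 ≤ x := not_lt.mp hx
      have hy' : 0 ≤ y := hx'.trans hxy
      simp only [hx, not_lt.mpr hy', if_false]
      exact hg.monotoneOn ⟨by positivity, min_le_right _ _⟩ ⟨by positivity, min_le_right _ _⟩
        (min_le_min_right _ hxy)
  right_continuous' := by
    intro x
    rcases lt_or_ge x 0 with hx | hx
    · have h : (fun y : ℝ => if y < 0 then (0 : ℝ) else g (min y 1)) =ᶠ[𝓝 x] fun _ => 0 := by
        filter_upwards [Iio_mem_nhds hx] with y hy
        simp only [mem_Iio] at hy
        simp [hy]
      exact (continuousAt_const.congr h.symm).continuousWithinAt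
    · have hcomp : ContinuousWithinAt (fun y : ℝ => g (min y 1)) (Ici x) x := by
        rcases lt_or_ge x 1 with h1 | h1
        · have hc := hg.right_continuous x ⟨hx, h1⟩
          have hm : min x 1 = x := min_eq_left h1.le
          refine ContinuousWithinAt.comp (t := Icc x 1) (g := g) (f := fun y : ℝ => min y 1)
            (by simpa [hm] using hc) (by fun_prop) ?_
          intro y hy
          exact ⟨le_min hy h1.le, min_le_right _ _⟩
        · refine (continuousWithinAt_const (b := g 1)).congr ?_ ?_
          · intro y hy
            rw [min_eq_right (h1.trans hy)]
          · rw [min_eq_right h1]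
      refine hcomp.congr ?_ ?_
      · intro y hy
        have : 0 ≤ y := hx.trans hy
        simp [not_lt.mpr this]
      · simp [not_lt.mpr hx]

/-- The Borel probability measure `μ_g`, carried by `[0,1]`, with `μ_g([0,u]) = g(u)` for
`u ∈ [0,1]`; in particular `μ_g({0}) = g(0)`. Integrals `∫₀¹ f dg` are with respect to it. -/
noncomputable def measure {g : ℝ → ℝ} (hg : IsDistortionFunction g) : Measure ℝ :=
  hg.stieltjes.measure

end IsDistortionFunction

/-- The quantile function `F_X⁻¹(u) = inf {x ∈ ℝ : F_X(x) ≥ u}` of a real random variable `X`,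
with values in `[-∞,∞]`. -/
noncomputable def quantile {Ω : Type*} [MeasurableSpace Ω] (P : Measure Ω) (X : Ω → ℝ)
    (u : ℝ) : EReal :=
  sInf ((fun x : ℝ => (x : EReal)) '' {x : ℝ | u ≤ cdf (P.map X) x})

/-- The quantity `φ(|x|/a)` for `x ∈ [-∞,∞]`, with `φ(∞) = ∞`. -/
noncomputable def youngAbs (φ : ℝ → ℝ) (a : ℝ) (x : EReal) : ℝ≥0∞ :=
  if x = ⊤ ∨ x = ⊥ then ∞ else ENNReal.ofReal (φ (|x.toReal| / a))

/-- The set `L_g^φ` of all real random variables `X` (modulo almost sure equality) such that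
`∫₀¹ φ(|F_X⁻¹(1-u)|/a) dg(u) < ∞` for some `a > 0`. -/
noncomputable def distortedOrlicz {Ω : Type*} [MeasurableSpace Ω] (P : Measure Ω) {g : ℝ → ℝ}
    (hg : IsDistortionFunction g) (φ : ℝ → ℝ) : Set (Ω →ₘ[P] ℝ) :=
  {X | ∃ a : ℝ, 0 < a ∧ ∫⁻ u in Icc (0 : ℝ) 1, youngAbs φ a (quantile P X (1 - u)) ∂hg.measure < ∞}

/-! ### Comparison of integrals of monotone functions through half-line masses -/

section StochasticDomination

/-! Only stability under sums is hard. The union bound for distribution functions bounds the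
quantile of `X + Y` at `1 - u` above by the sum of the quantiles at `1 - u/2`, and at `v` below by
the sum of those at `v/2`. Positive and negative parts are therefore treated separately, and each
costs a change of variable in the integral against `μ_g`.

Positive parts need `u ↦ u/2`: concavity gives `g(2x) ≤ 2 g(x)`, so the integral at most doubles
(`lintegral_comp_half_le`). Negative parts need `u ↦ (1+u)/2`, which moves mass towards `1`, where
the integrand may blow up. Under (i) `μ_g` lives on `[0,u₀]` and the shifted integrand is bounded
there; under (ii) `1 - g(x)` lies between `g'(1)(1-x)` and `1 - x`, so the cost is a factor
`2/g'(1)`. -/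

lemma lintegral_le_mul_of_superlevel_le {m₁ m₂ : Measure ℝ} {C : ℝ≥0∞} {f : ℝ → ℝ≥0∞}
    (hf : Measurable f) (h : ∀ t : ℝ≥0∞, m₁ {u | t < f u} ≤ C * m₂ {u | t < f u}) :
    ∫⁻ u, f u ∂m₁ ≤ C * ∫⁻ u, f u ∂m₂ := by
  -- The layer-cake formula is for real-valued functions, hence the truncation at `n`, removed at
  -- the end by monotone convergence.
  have htrunc : ∀ (m : Measure ℝ) (n : ℕ), ∫⁻ u, min (f u) n ∂m
      = ∫⁻ t in Ioi (0 : ℝ), m {u | ENNReal.ofReal t < min (f u) n} := by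
    intro m n
    have hfin : ∀ u, min (f u) (n : ℝ≥0∞) ≠ ∞ := fun u =>
      ((min_le_right _ _).trans_lt (ENNReal.natCast_lt_top n)).ne
    have hm : Measurable fun u => (min (f u) (n : ℝ≥0∞)).toReal :=
      (hf.min measurable_const).ennreal_toReal
    have key := lintegral_eq_lintegral_meas_lt m (f := fun u => (min (f u) (n : ℝ≥0∞)).toReal)
      (ae_of_all _ fun u => ENNReal.toReal_nonneg) hm.aemeasurable
    simp only [ENNReal.ofReal_toReal (hfin _)] at key
    rw [key]
    refine setLIntegral_congr_fun measurableSet_Ioi fun t ht => ?_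
    simp only [ENNReal.ofReal_lt_iff_lt_toReal (le_of_lt ht) (hfin _)]
  have hn : ∀ n : ℕ, ∫⁻ u, min (f u) n ∂m₁ ≤ C * ∫⁻ u, f u ∂m₂ := by
    intro n
    calc ∫⁻ u, min (f u) n ∂m₁
        = ∫⁻ t in Ioi (0 : ℝ), m₁ {u | ENNReal.ofReal t < min (f u) n} := htrunc m₁ n
      _ ≤ ∫⁻ t in Ioi (0 : ℝ), C * m₂ {u | ENNReal.ofReal t < min (f u) n} := by
          refine lintegral_mono fun t => ?_
          by_cases htn : ENNReal.ofReal t < n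
          · simpa [lt_min_iff, htn] using h (ENNReal.ofReal t)
          · simp [htn]
      _ = C * ∫⁻ t in Ioi (0 : ℝ), m₂ {u | ENNReal.ofReal t < min (f u) n} := by
          refine lintegral_const_mul _ (Antitone.measurable fun s t hst => ?_)
          exact measure_mono fun u hu => (ENNReal.ofReal_le_ofReal hst).trans_lt hu
      _ = C * ∫⁻ u, min (f u) n ∂m₂ := by rw [htrunc m₂ n]
      _ ≤ C * ∫⁻ u, f u ∂m₂ := by gcongr; exact min_le_left _ _
  have hsup : ∀ u, f u = ⨆ n : ℕ, min (f u) (n : ℝ≥0∞) := by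
    intro u
    rw [← inf_iSup_eq, ENNReal.iSup_natCast, inf_top_eq]
  calc ∫⁻ u, f u ∂m₁ = ∫⁻ u, ⨆ n : ℕ, min (f u) (n : ℝ≥0∞) ∂m₁ := by simp_rw [← hsup]
    _ = ⨆ n : ℕ, ∫⁻ u, min (f u) (n : ℝ≥0∞) ∂m₁ := by
        refine lintegral_iSup (fun n => hf.min measurable_const) fun i j hij u => ?_
        exact min_le_min_left _ (by exact_mod_cast hij)
    _ ≤ _ := iSup_le hn

/-- Superlevel sets are lower sets, open or closed at the endpoint. Inner regularity avoids the
distinction: a compact `K` inside one lies in `Iic (max K)`, which the superlevel set still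
contains. -/
lemma Antitone.lintegral_le_mul {m₁ m₂ : Measure ℝ} [IsFiniteMeasure m₁] {C : ℝ≥0∞}
    {f : ℝ → ℝ≥0∞} (hf : Antitone f) (h : ∀ x, m₁ (Iic x) ≤ C * m₂ (Iic x)) :
    ∫⁻ u, f u ∂m₁ ≤ C * ∫⁻ u, f u ∂m₂ := by
  refine lintegral_le_mul_of_superlevel_le hf.measurable fun t => ?_
  have hms : MeasurableSet {u | t < f u} := hf.measurable measurableSet_Ioi
  rw [hms.measure_eq_iSup_isCompact_of_ne_top (measure_ne_top _ _)]
  refine iSup₂_le fun K hK => iSup_le fun hKc => ?_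
  rcases K.eq_empty_or_nonempty with rfl | hne
  · simp
  obtain ⟨x, hx, hmax⟩ := hKc.exists_isGreatest hne
  calc m₁ K ≤ m₁ (Iic x) := measure_mono hmax
    _ ≤ C * m₂ (Iic x) := h x
    _ ≤ _ := by gcongr; exact fun y hy => (hK hx).trans_le (hf hy)

lemma Monotone.lintegral_le_mul {m₁ m₂ : Measure ℝ} [IsFiniteMeasure m₁] {C : ℝ≥0∞}
    {f : ℝ → ℝ≥0∞} (hf : Monotone f) (h : ∀ x, m₁ (Ici x) ≤ C * m₂ (Ici x)) :
    ∫⁻ u, f u ∂m₁ ≤ C * ∫⁻ u, f u ∂m₂ := by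
  refine lintegral_le_mul_of_superlevel_le hf.measurable fun t => ?_
  have hms : MeasurableSet {u | t < f u} := hf.measurable measurableSet_Ioi
  rw [hms.measure_eq_iSup_isCompact_of_ne_top (measure_ne_top _ _)]
  refine iSup₂_le fun K hK => iSup_le fun hKc => ?_
  rcases K.eq_empty_or_nonempty with rfl | hne
  · simp
  obtain ⟨x, hx, hmin⟩ := hKc.exists_isLeast hne
  calc m₁ K ≤ m₁ (Ici x) := measure_mono hmin
    _ ≤ C * m₂ (Ici x) := h x
    _ ≤ _ := by gcongr; exact fun y hy => (hK hx).trans_le (hf hy)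

end StochasticDomination

/-! ### The measure `μ_g` and the two changes of variable -/

namespace IsDistortionFunction

variable {g : ℝ → ℝ} (hg : IsDistortionFunction g)

lemma stieltjes_of_neg {x : ℝ} (hx : x < 0) : hg.stieltjes x = 0 := if_pos hx

lemma stieltjes_of_nonneg {x : ℝ} (hx : 0 ≤ x) : hg.stieltjes x = g (min x 1) :=
  if_neg (not_lt.mpr hx)

lemma stieltjes_of_mem {x : ℝ} (hx : x ∈ Icc (0 : ℝ) 1) : hg.stieltjes x = g x := by
  rw [hg.stieltjes_of_nonneg hx.1, min_eq_left hx.2]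

lemma stieltjes_of_one_le {x : ℝ} (hx : 1 ≤ x) : hg.stieltjes x = 1 := by
  rw [hg.stieltjes_of_nonneg (zero_le_one.trans hx), min_eq_right hx, hg.map_one]

lemma tendsto_stieltjes_atBot : Tendsto hg.stieltjes atBot (𝓝 0) :=
  tendsto_const_nhds.congr' <| by
    filter_upwards [eventually_lt_atBot 0] with x hx using (hg.stieltjes_of_neg hx).symm

lemma tendsto_stieltjes_atTop : Tendsto hg.stieltjes atTop (𝓝 1) :=
  tendsto_const_nhds.congr' <| by
    filter_upwards [eventually_ge_atTop 1] with x hx using (hg.stieltjes_of_one_le hx).symm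

lemma measure_Iic (x : ℝ) : hg.measure (Iic x) = ENNReal.ofReal (hg.stieltjes x) := by
  rw [measure, hg.stieltjes.measure_Iic hg.tendsto_stieltjes_atBot, sub_zero]

lemma measure_Ici (x : ℝ) :
    hg.measure (Ici x) = ENNReal.ofReal (1 - Function.leftLim hg.stieltjes x) := by
  rw [measure, hg.stieltjes.measure_Ici hg.tendsto_stieltjes_atTop]

instance isProbabilityMeasure_measure : IsProbabilityMeasure hg.measure :=
  ⟨by rw [measure, hg.stieltjes.measure_univ hg.tendsto_stieltjes_atBot
    hg.tendsto_stieltjes_atTop]; simp⟩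

/-- The left limit of `g` at `1` excludes an atom there, which matters because the quantile at `1 -
1 = 0` is `-∞`. -/
lemma ae_mem_Ico : ∀ᵐ u ∂hg.measure, u ∈ Ico (0 : ℝ) 1 := by
  have h0 : hg.measure (Iio 0) = 0 := by
    rw [measure, hg.stieltjes.measure_Iio hg.tendsto_stieltjes_atBot]
    have : Function.leftLim hg.stieltjes 0 = 0 :=
      leftLim_eq_of_tendsto <| tendsto_const_nhds.congr' <| by
        filter_upwards [self_mem_nhdsWithin] with x hx using (hg.stieltjes_of_neg hx).symm
    simp [this]
  have h1 : hg.measure (Ici 1) = 0 := by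
    rw [hg.measure_Ici]
    have : Function.leftLim hg.stieltjes 1 = 1 :=
      leftLim_eq_of_tendsto <| hg.tendsto_one.congr' <| by
        filter_upwards [Ioo_mem_nhdsLT (zero_lt_one' ℝ)] with x hx
          using (hg.stieltjes_of_mem ⟨hx.1.le, hx.2.le⟩).symm
    simp [this]
  filter_upwards [measure_eq_zero_iff_ae_notMem.mp h0, measure_eq_zero_iff_ae_notMem.mp h1]
    with u hu0 hu1 using ⟨not_lt.mp hu0, not_le.mp hu1⟩

lemma restrict_measure_Icc : hg.measure.restrict (Icc 0 1) = hg.measure :=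
  Measure.restrict_eq_self_of_ae_mem <| by
    filter_upwards [hg.ae_mem_Ico] with u hu using ⟨hu.1, hu.2.le⟩

lemma stieltjes_two_mul_le (hconc : ConcaveOn ℝ (Icc 0 1) g) (x : ℝ) :
    hg.stieltjes (2 * x) ≤ 2 * hg.stieltjes x := by
  rcases lt_or_ge x 0 with hx | hx
  · simp [hg.stieltjes_of_neg hx, hg.stieltjes_of_neg (show 2 * x < 0 by linarith)]
  rw [hg.stieltjes_of_nonneg hx, hg.stieltjes_of_nonneg (by linarith : 0 ≤ 2 * x)]
  set y := min (2 * x) 1 with hy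
  have hyI : y ∈ Icc (0 : ℝ) 1 := ⟨le_min (by linarith) zero_le_one, min_le_right _ _⟩
  have h0 : (0 : ℝ) ∈ Icc (0 : ℝ) 1 := ⟨le_rfl, zero_le_one⟩
  have hc := hconc.2 hyI h0 (by norm_num : (0 : ℝ) ≤ 1 / 2) (by norm_num : (0 : ℝ) ≤ 1 / 2)
    (by norm_num)
  have hmono : g (1 / 2 * y) ≤ g (min x 1) := by
    have h2 : y ≤ 2 * x := min_le_left _ _
    refine hg.monotoneOn ⟨by linarith [hyI.1], by linarith [hyI.2]⟩
      ⟨le_min hx zero_le_one, min_le_right _ _⟩ (le_min (by linarith) (by linarith [hyI.2]))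
  simp only [smul_eq_mul, mul_zero, add_zero] at hc
  linarith [(hg.mapsTo h0).1]

lemma le_stieltjes (hconc : ConcaveOn ℝ (Icc 0 1) g) {x : ℝ} (hx : x ≤ 1) :
    x ≤ hg.stieltjes x := by
  rcases lt_or_ge x 0 with hx0 | hx0
  · rw [hg.stieltjes_of_neg hx0]; exact hx0.le
  rw [hg.stieltjes_of_mem ⟨hx0, hx⟩]
  have h0 : (0 : ℝ) ∈ Icc (0 : ℝ) 1 := ⟨le_rfl, zero_le_one⟩
  have h1 : (1 : ℝ) ∈ Icc (0 : ℝ) 1 := ⟨zero_le_one, le_rfl⟩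
  have hc := hconc.2 h1 h0 hx0 (sub_nonneg.mpr hx) (by ring)
  simp only [smul_eq_mul, mul_zero, add_zero, mul_one, hg.map_one] at hc
  nlinarith [(hg.mapsTo h0).1]

/-- A concave graph lies below its tangent at `1`. The truncation by `1` covers `x < 0`, where `d ≤
1 - g 0 ≤ 1`. -/
lemma stieltjes_le_of_hasDerivWithinAt (hconc : ConcaveOn ℝ (Icc 0 1) g) {d : ℝ}
    (hderiv : HasDerivWithinAt g d (Icc 0 1) 1) {x : ℝ} (hx : x ≤ 1) :
    d * min (1 - x) 1 ≤ 1 - hg.stieltjes x := by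
  have h1 : (1 : ℝ) ∈ Icc (0 : ℝ) 1 := ⟨zero_le_one, le_rfl⟩
  have hI : ∀ y ∈ Icc (0 : ℝ) 1, d * (1 - y) ≤ 1 - g y := by
    intro y hy
    rcases hy.2.eq_or_lt with rfl | hy1
    · simp [hg.map_one]
    have := hconc.le_slope_of_hasDerivWithinAt hy h1 hy1 hderiv
    rwa [slope_def_field, hg.map_one, le_div_iff₀ (by linarith)] at this
  rcases lt_or_ge x 0 with hx0 | hx0
  · have h0 : (0 : ℝ) ∈ Icc (0 : ℝ) 1 := ⟨le_rfl, zero_le_one⟩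
    rw [hg.stieltjes_of_neg hx0, min_eq_right (by linarith)]
    linarith [hI 0 h0, (hg.mapsTo h0).1]
  · rw [hg.stieltjes_of_mem ⟨hx0, hx⟩, min_eq_left (by linarith)]
    exact hI x ⟨hx0, hx⟩

lemma lintegral_comp_half_le (hconc : ConcaveOn ℝ (Icc 0 1) g) {f : ℝ → ℝ≥0∞} (hf : Antitone f) :
    ∫⁻ u, f (u / 2) ∂hg.measure ≤ 2 * ∫⁻ u, f u ∂hg.measure := by
  have hm : Measurable fun u : ℝ => u / 2 := by fun_prop
  rw [← lintegral_map hf.measurable hm]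
  have : IsFiniteMeasure (hg.measure.map fun u : ℝ => u / 2) :=
    Measure.isFiniteMeasure_map _ _
  refine hf.lintegral_le_mul fun x => ?_
  have hpre : (fun u : ℝ => u / 2) ⁻¹' Iic x = Iic (2 * x) := by
    ext u; simp only [mem_preimage, mem_Iic]; constructor <;> intro h <;> linarith
  rw [Measure.map_apply hm measurableSet_Iic, hpre, hg.measure_Iic, hg.measure_Iic,
    ← ENNReal.ofReal_ofNat 2, ← ENNReal.ofReal_mul zero_le_two]
  exact ENNReal.ofReal_le_ofReal (hg.stieltjes_two_mul_le hconc x)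

lemma lintegral_comp_midpoint_one_le (hconc : ConcaveOn ℝ (Icc 0 1) g) {d : ℝ} (hd : 0 < d)
    (hderiv : HasDerivWithinAt g d (Icc 0 1) 1) {f : ℝ → ℝ≥0∞} (hf : Monotone f) :
    ∫⁻ u, f ((1 + u) / 2) ∂hg.measure ≤ ENNReal.ofReal (2 / d) * ∫⁻ u, f u ∂hg.measure := by
  have hm : Measurable fun u : ℝ => (1 + u) / 2 := by fun_prop
  rw [← lintegral_map hf.measurable hm]
  have : IsFiniteMeasure (hg.measure.map fun u : ℝ => (1 + u) / 2) :=
    Measure.isFiniteMeasure_map _ _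
  refine hf.lintegral_le_mul fun x => ?_
  have hpre : (fun u : ℝ => (1 + u) / 2) ⁻¹' Ici x = Ici (2 * x - 1) := by
    ext u; simp only [mem_preimage, mem_Ici]; constructor <;> intro h <;> linarith
  rw [Measure.map_apply hm measurableSet_Ici, hpre, hg.measure_Ici, hg.measure_Ici,
    ← ENNReal.ofReal_mul (by positivity)]
  have hmono := hg.stieltjes.mono
  rcases lt_or_ge 1 x with hx | hx
  · have : 1 ≤ Function.leftLim hg.stieltjes (2 * x - 1) := by
      refine (hg.stieltjes_of_one_le le_rfl).symm.trans_le ?_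
      exact hmono.le_leftLim (by linarith)
    rw [ENNReal.ofReal_of_nonpos (by linarith)]
    exact zero_le
  refine ENNReal.ofReal_le_ofReal ?_
  -- At `y = 2x - 1` this bounds the shifted tail by `min (2(1-x)) 1`, hence by `2 * min (1-x) 1`.
  have hlow : ∀ y ≤ (1 : ℝ), max y 0 ≤ Function.leftLim hg.stieltjes y := by
    intro y hy
    refine max_le (le_of_forall_lt fun z hz => ?_) ?_
    · obtain ⟨w, hzw, hwy⟩ := exists_between hz
      exact hzw.trans_le ((hg.le_stieltjes hconc (hwy.le.trans hy)).trans (hmono.le_leftLim hwy))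
    · have h0 : hg.stieltjes (min y 0 - 1) = 0 :=
        hg.stieltjes_of_neg (by linarith [min_le_right y 0])
      rw [← h0]
      exact hmono.le_leftLim (by linarith [min_le_left y 0])
  have h1 := hlow (2 * x - 1) (by linarith)
  have h2 : Function.leftLim hg.stieltjes x ≤ hg.stieltjes x := hmono.leftLim_le le_rfl
  have h3 := hg.stieltjes_le_of_hasDerivWithinAt hconc hderiv hx
  have h4 : 2 * min (1 - x) 1 ≤ 2 / d * (1 - hg.stieltjes x) := by
    rw [div_mul_eq_mul_div, le_div_iff₀ hd]; linarith
  have h5 : 2 / d * (1 - hg.stieltjes x) ≤ 2 / d * (1 - Function.leftLim hg.stieltjes x) := by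
    gcongr
  refine le_trans ?_ (h4.trans h5)
  rcases min_cases (1 - x) 1 with ⟨h, -⟩ | ⟨h, -⟩ <;> rw [h]
  · linarith [le_max_left (2 * x - 1) 0]
  · linarith [le_max_right (2 * x - 1) 0]

lemma lintegral_comp_midpoint_one_lt_top (hconc : ConcaveOn ℝ (Icc 0 1) g)
    (h : (∃ u₀ ∈ Ico (0 : ℝ) 1, ∀ u ∈ Icc u₀ 1, g u = g u₀) ∨
      (∃ d : ℝ, 0 < d ∧ HasDerivWithinAt g d (Icc 0 1) 1))
    {f : ℝ → ℝ≥0∞} (hf : Monotone f) (hfin : ∀ u < 1, f u < ∞)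
    (hint : ∫⁻ u, f u ∂hg.measure < ∞) : ∫⁻ u, f ((1 + u) / 2) ∂hg.measure < ∞ := by
  rcases h with ⟨u₀, hu₀, hconst⟩ | ⟨d, hd, hderiv⟩
  · have hnull : hg.measure (Ioi u₀) = 0 := by
      rw [measure, hg.stieltjes.measure_Ioi hg.tendsto_stieltjes_atTop,
        hg.stieltjes_of_mem ⟨hu₀.1, hu₀.2.le⟩, ← hconst 1 ⟨hu₀.2.le, le_rfl⟩, hg.map_one]
      simp
    calc ∫⁻ u, f ((1 + u) / 2) ∂hg.measure ≤ ∫⁻ _, f ((1 + u₀) / 2) ∂hg.measure := by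
          refine lintegral_mono_ae ?_
          filter_upwards [measure_eq_zero_iff_ae_notMem.mp hnull] with u hu
          exact hf (by linarith [not_lt.mp (mem_Ioi.not.mp hu)])
      _ < ∞ := by
          simpa using hfin _ (by linarith [hu₀.2])
  · exact (hg.lintegral_comp_midpoint_one_le hconc hd hderiv hf).trans_lt
      (ENNReal.mul_lt_top ENNReal.ofReal_lt_top hint)

end IsDistortionFunction

/-! ### Monotonicity of Young functions and of `youngAbs` -/

namespace IsYoungFunction

lemma monotoneOn {φ : ℝ → ℝ} (hφ : IsYoungFunction φ) : MonotoneOn φ (Ici 0) := by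
  intro s hs t ht hst
  rcases (mem_Ici.mp ht).eq_or_lt with rfl | ht0
  · rw [le_antisymm hst hs]
  have hc := hφ.convexOn.2 ht (mem_Ici.mpr le_rfl) (div_nonneg hs ht0.le)
    (sub_nonneg.mpr ((div_le_one ht0).mpr hst)) (by ring)
  simp only [smul_eq_mul, mul_zero, add_zero, hφ.map_zero, div_mul_cancel₀ _ ht0.ne'] at hc
  exact hc.trans (mul_le_of_le_one_left (hφ.nonneg t ht) ((div_le_one ht0).mpr hst))

end IsYoungFunction

section YoungAbs

variable {φ : ℝ → ℝ} {a : ℝ}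

@[simp] lemma youngAbs_top : youngAbs φ a ⊤ = ∞ := by simp [youngAbs]

@[simp] lemma youngAbs_bot : youngAbs φ a ⊥ = ∞ := by simp [youngAbs]

lemma youngAbs_coe (x : ℝ) : youngAbs φ a x = ENNReal.ofReal (φ (|x| / a)) := by simp [youngAbs]

lemma youngAbs_zero (hφ : IsYoungFunction φ) : youngAbs φ a 0 = 0 := by
  rw [← EReal.coe_zero, youngAbs_coe]; simp [hφ.map_zero]

lemma youngAbs_lt_top {x : EReal} (hb : x ≠ ⊥) (ht : x ≠ ⊤) : youngAbs φ a x < ∞ := by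
  lift x to ℝ using ⟨ht, hb⟩
  rw [youngAbs_coe]; exact ENNReal.ofReal_lt_top

lemma youngAbs_mul {c : ℝ} (hc : 0 < c) (x : EReal) :
    youngAbs φ (c * a) (c * x) = youngAbs φ a x := by
  induction x with
  | bot => simp [EReal.coe_mul_bot_of_pos hc]
  | top => simp [EReal.coe_mul_top_of_pos hc]
  | coe x =>
    rw [← EReal.coe_mul, youngAbs_coe, youngAbs_coe, abs_mul, abs_of_pos hc,
      mul_div_mul_left _ _ hc.ne']

lemma youngAbs_coe_le (hφ : IsYoungFunction φ) {b x y : ℝ} (ha : 0 < a) (hab : a ≤ b)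
    (hxy : |x| ≤ |y|) : youngAbs φ b x ≤ youngAbs φ a y := by
  rw [youngAbs_coe, youngAbs_coe]
  have hb : 0 < b := ha.trans_le hab
  exact ENNReal.ofReal_le_ofReal <| hφ.monotoneOn (mem_Ici.mpr (by positivity))
    (mem_Ici.mpr (by positivity)) (by gcongr)

lemma youngAbs_anti_scale (hφ : IsYoungFunction φ) {b : ℝ} (ha : 0 < a) (hab : a ≤ b) (x : EReal) :
    youngAbs φ b x ≤ youngAbs φ a x := by
  induction x with
  | bot => simp
  | top => simp
  | coe x => exact youngAbs_coe_le hφ ha hab le_rfl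

lemma youngAbs_le_of_nonneg (hφ : IsYoungFunction φ) (ha : 0 < a) {x y : EReal} (hx : 0 ≤ x)
    (hxy : x ≤ y) : youngAbs φ a x ≤ youngAbs φ a y := by
  induction y with
  | bot => simp
  | top => simp
  | coe y =>
    lift x to ℝ using ⟨(hxy.trans_lt (EReal.coe_lt_top y)).ne,
      (EReal.bot_lt_zero.trans_le hx).ne'⟩
    norm_cast at hx hxy
    exact youngAbs_coe_le hφ ha le_rfl (abs_le_abs_of_nonneg hx hxy)

lemma youngAbs_le_of_nonpos (hφ : IsYoungFunction φ) (ha : 0 < a) {x y : EReal} (hx : x ≤ 0)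
    (hyx : y ≤ x) : youngAbs φ a x ≤ youngAbs φ a y := by
  induction y with
  | bot => simp
  | top => simp
  | coe y =>
    lift x to ℝ using ⟨(hx.trans_lt EReal.zero_lt_top).ne,
      ((EReal.bot_lt_coe y).trans_le hyx).ne'⟩
    norm_cast at hx hyx
    refine youngAbs_coe_le hφ ha le_rfl ?_
    rw [abs_of_nonpos hx, abs_of_nonpos (hyx.trans hx)]; linarith

lemma monotone_youngAbs_max_zero (hφ : IsYoungFunction φ) (ha : 0 < a) :
    Monotone fun x => youngAbs φ a (max x 0) := fun _ _ h =>
  youngAbs_le_of_nonneg hφ ha (le_max_right _ _) (max_le_max_right _ h)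

lemma antitone_youngAbs_min_zero (hφ : IsYoungFunction φ) (ha : 0 < a) :
    Antitone fun x => youngAbs φ a (min x 0) := fun _ _ h =>
  youngAbs_le_of_nonpos hφ ha (min_le_right _ _) (min_le_min_right _ h)

/-- `youngAbs` is not monotone on the extended line, but each of these summands is. -/
lemma youngAbs_eq_max_add_min (hφ : IsYoungFunction φ) (x : EReal) :
    youngAbs φ a x = youngAbs φ a (max x 0) + youngAbs φ a (min x 0) := by
  rcases le_total x 0 with h | h <;> simp [h, youngAbs_zero hφ]

end YoungAbs

/-! ### Quantiles of sums and multiples -/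

section Quantile

variable {Ω : Type*} [MeasurableSpace Ω] {P : Measure Ω}

lemma quantile_congr {X Y : Ω → ℝ} (h : X =ᵐ[P] Y) : quantile P X = quantile P Y := by
  unfold quantile; rw [Measure.map_congr h]

lemma monotone_quantile (X : Ω → ℝ) : Monotone (quantile P X) := fun _ _ h =>
  sInf_le_sInf <| image_mono fun _ hx => h.trans hx

/-- Right-continuity of the distribution function puts a finite infimum in its set. -/
lemma quantile_le_coe_iff (X : Ω → ℝ) (v x : ℝ) :
    quantile P X v ≤ x ↔ v ≤ cdf (P.map X) x := by
  refine ⟨fun h => ?_, fun h => sInf_le ⟨x, h, rfl⟩⟩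
  have hright : Tendsto (cdf (P.map X)) (𝓝[>] x) (𝓝 (cdf (P.map X) x)) :=
    ((cdf (P.map X)).right_continuous x).mono Ioi_subset_Ici_self
  refine ge_of_tendsto hright ?_
  filter_upwards [self_mem_nhdsWithin] with y hy
  have hlt : quantile P X v < y := h.trans_lt (EReal.coe_lt_coe_iff.mpr hy)
  obtain ⟨-, ⟨z, hz, rfl⟩, hzy⟩ := sInf_lt_iff.mp hlt
  exact hz.trans (monotone_cdf _ (EReal.coe_lt_coe_iff.mp hzy).le)

lemma coe_lt_quantile_iff (X : Ω → ℝ) (v x : ℝ) :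
    x < quantile P X v ↔ cdf (P.map X) x < v := by
  rw [← not_le, quantile_le_coe_iff, not_le]

lemma bot_lt_quantile (X : Ω → ℝ) {v : ℝ} (hv : 0 < v) : ⊥ < quantile P X v := by
  obtain ⟨x, hx⟩ := ((tendsto_cdf_atBot (P.map X)).eventually (gt_mem_nhds hv)).exists
  exact bot_le.trans_lt ((coe_lt_quantile_iff X v x).mpr hx)

variable [IsProbabilityMeasure P]

lemma cdf_map_eq {X : Ω → ℝ} (hX : AEMeasurable X P) (x : ℝ) :
    cdf (P.map X) x = P.real {ω | X ω ≤ x} := by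
  have := Measure.isProbabilityMeasure_map hX
  rw [cdf_eq_real, map_measureReal_apply_of_aemeasurable hX measurableSet_Iic]
  rfl

lemma cdf_map_add_le {X Y : Ω → ℝ} (hX : AEMeasurable X P) (hY : AEMeasurable Y P) (x y : ℝ) :
    cdf (P.map (X + Y)) (x + y) ≤ cdf (P.map X) x + cdf (P.map Y) y := by
  rw [cdf_map_eq hX, cdf_map_eq hY, cdf_map_eq (hX.add hY)]
  refine (measureReal_mono fun ω hω => ?_).trans (measureReal_union_le _ _)
  by_contra hcon
  simp only [mem_union, mem_ofPred_eq, not_or, not_le, Pi.add_apply] at hcon hω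
  linarith

lemma le_cdf_map_add {X Y : Ω → ℝ} (hX : AEMeasurable X P) (hY : AEMeasurable Y P) (x y : ℝ) :
    cdf (P.map X) x + cdf (P.map Y) y - 1 ≤ cdf (P.map (X + Y)) (x + y) := by
  rw [cdf_map_eq hX, cdf_map_eq hY, cdf_map_eq (hX.add hY)]
  have hYm : NullMeasurableSet {ω | Y ω ≤ y} P := hY.nullMeasurableSet_preimage measurableSet_Iic
  have h1 := measureReal_union_add_inter₀ (μ := P) (s := {ω | X ω ≤ x}) hYm
  have h2 : P.real ({ω | X ω ≤ x} ∪ {ω | Y ω ≤ y}) ≤ 1 := measureReal_le_one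
  have h3 : P.real ({ω | X ω ≤ x} ∩ {ω | Y ω ≤ y}) ≤ P.real {ω | (X + Y) ω ≤ x + y} :=
    measureReal_mono fun ω hω => mem_ofPred.mpr (add_le_add hω.1 hω.2)
  linarith

lemma quantile_const_mul {X : Ω → ℝ} (hX : AEMeasurable X P) {c : ℝ} (hc : 0 < c) (v : ℝ) :
    quantile P (fun ω => c * X ω) v = c * quantile P X v := by
  have key : ∀ z : ℝ, quantile P (fun ω => c * X ω) v ≤ z ↔ c * quantile P X v ≤ z := by
    intro z
    have hcdf : cdf (P.map fun ω => c * X ω) z = cdf (P.map X) (z / c) := by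
      rw [cdf_map_eq hX, cdf_map_eq (hX.const_mul c)]
      simp_rw [le_div_iff₀' hc]
    rw [quantile_le_coe_iff, hcdf, ← quantile_le_coe_iff]
    induction quantile P X v with
    | bot => simp [EReal.coe_mul_bot_of_pos hc]
    | top => simp [EReal.coe_mul_top_of_pos hc]
    | coe q => norm_cast; rw [le_div_iff₀' hc]
  exact le_antisymm (EReal.le_of_forall_lt_iff_le.mp fun z hz => (key z).mpr hz.le)
    (EReal.le_of_forall_lt_iff_le.mp fun z hz => (key z).mp hz.le)

/-- The sum of the two quantiles is at most twice their maximum `m`; the scale `2 * a` absorbs the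
factor, and `φ(m/a)` is one of the two summands. -/
lemma youngAbs_max_quantile_add_le {φ : ℝ → ℝ} (hφ : IsYoungFunction φ) {a : ℝ} (ha : 0 < a)
    {X Y : Ω → ℝ} (hX : AEMeasurable X P) (hY : AEMeasurable Y P) (u : ℝ) :
    youngAbs φ (2 * a) (max (quantile P (X + Y) (1 - u)) 0)
      ≤ youngAbs φ a (max (quantile P X (1 - u / 2)) 0)
        + youngAbs φ a (max (quantile P Y (1 - u / 2)) 0) := by
  set p := quantile P X (1 - u / 2) with hp
  set q := quantile P Y (1 - u / 2) with hq
  have hm := monotone_youngAbs_max_zero hφ ha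
  have hsum : youngAbs φ a (max (max p q) 0)
      ≤ youngAbs φ a (max p 0) + youngAbs φ a (max q 0) := by
    rw [hm.map_max]
    exact max_le le_self_add le_add_self
  refine le_trans ?_ hsum
  by_cases ht : max (max p q) 0 = ⊤
  · simp [ht]
  obtain ⟨m, hm⟩ : ∃ m : ℝ, (m : EReal) = max (max p q) 0 :=
    ⟨_, EReal.coe_toReal ht (EReal.bot_lt_zero.trans_le (le_max_right _ _)).ne'⟩
  have hm0 : (0 : EReal) ≤ m := hm ▸ le_max_right _ _
  have hpm : p ≤ m := hm ▸ (le_max_left p q).trans (le_max_left _ _)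
  have hqm : q ≤ m := hm ▸ (le_max_right p q).trans (le_max_left _ _)
  have hle : quantile P (X + Y) (1 - u) ≤ (m + m : ℝ) := by
    rw [quantile_le_coe_iff]
    have h1 := (quantile_le_coe_iff _ _ _).mp hpm
    have h2 := (quantile_le_coe_iff _ _ _).mp hqm
    linarith [le_cdf_map_add hX hY m m]
  have h2m : ((m + m : ℝ) : EReal) = (2 : ℝ) * (m : EReal) := by
    rw [← two_mul, EReal.coe_mul]
  rw [← hm, ← youngAbs_mul zero_lt_two (m : EReal), ← h2m]
  refine youngAbs_le_of_nonneg hφ (by positivity) (le_max_right _ _) (max_le hle ?_)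
  norm_cast at hm0 ⊢
  linarith

lemma youngAbs_min_quantile_add_le {φ : ℝ → ℝ} (hφ : IsYoungFunction φ) {a : ℝ} (ha : 0 < a)
    {X Y : Ω → ℝ} (hX : AEMeasurable X P) (hY : AEMeasurable Y P) (v : ℝ) :
    youngAbs φ (2 * a) (min (quantile P (X + Y) v) 0)
      ≤ youngAbs φ a (min (quantile P X (v / 2)) 0)
        + youngAbs φ a (min (quantile P Y (v / 2)) 0) := by
  set p := quantile P X (v / 2) with hp
  set q := quantile P Y (v / 2) with hq
  have hm := antitone_youngAbs_min_zero hφ ha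
  have hsum : youngAbs φ a (min (min p q) 0)
      ≤ youngAbs φ a (min p 0) + youngAbs φ a (min q 0) := by
    rw [hm.map_min]
    exact max_le le_self_add le_add_self
  refine le_trans ?_ hsum
  by_cases hb : min (min p q) 0 = ⊥
  · simp [hb]
  obtain ⟨m, hm⟩ : ∃ m : ℝ, (m : EReal) = min (min p q) 0 :=
    ⟨_, EReal.coe_toReal ((min_le_right _ _).trans_lt EReal.zero_lt_top).ne hb⟩
  have hm0 : (m : EReal) ≤ 0 := hm ▸ min_le_right _ _
  have hpm : m ≤ p := hm ▸ (min_le_left _ _).trans (min_le_left p q)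
  have hqm : m ≤ q := hm ▸ (min_le_left _ _).trans (min_le_right p q)
  have hle : ((m + m : ℝ) : EReal) ≤ quantile P (X + Y) v := by
    refine EReal.ge_of_forall_gt_iff_ge.mp fun z hz => ?_
    -- Lower bounds on a quantile are characterised by strict inequality only, so `m` is approached
    -- from below.
    have hzm : z / 2 < m := by linarith [EReal.coe_lt_coe_iff.mp hz]
    have h1 := (coe_lt_quantile_iff _ _ _).mp ((EReal.coe_lt_coe_iff.mpr hzm).trans_le hpm)
    have h2 := (coe_lt_quantile_iff _ _ _).mp ((EReal.coe_lt_coe_iff.mpr hzm).trans_le hqm)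
    refine ((coe_lt_quantile_iff _ _ _).mpr ?_).le
    have h3 := cdf_map_add_le hX hY (z / 2) (z / 2)
    rw [add_halves] at h3
    linarith
  have h2m : ((m + m : ℝ) : EReal) = (2 : ℝ) * (m : EReal) := by
    rw [← two_mul, EReal.coe_mul]
  rw [← hm, ← youngAbs_mul zero_lt_two (m : EReal), ← h2m]
  refine youngAbs_le_of_nonpos hφ (by positivity) (min_le_right _ _) (le_min hle ?_)
  norm_cast at hm0 ⊢
  linarith

end Quantile

/-! ### The cone properties -/

section DistortedOrlicz

variable {Ω : Type*} [MeasurableSpace Ω] {P : Measure Ω} {g φ : ℝ → ℝ}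
  (hg : IsDistortionFunction g)

lemma mem_distortedOrlicz_iff {X : Ω →ₘ[P] ℝ} {Y : Ω → ℝ} (hXY : X =ᵐ[P] Y) :
    X ∈ distortedOrlicz P hg φ ↔
      ∃ a : ℝ, 0 < a ∧ ∫⁻ u, youngAbs φ a (quantile P Y (1 - u)) ∂hg.measure < ∞ := by
  rw [distortedOrlicz, mem_ofPred_eq, hg.restrict_measure_Icc, quantile_congr hXY]

variable [IsProbabilityMeasure P]

lemma lintegral_youngAbs_quantile_add_lt_top (hconc : ConcaveOn ℝ (Icc 0 1) g)
    (h : (∃ u₀ ∈ Ico (0 : ℝ) 1, ∀ u ∈ Icc u₀ 1, g u = g u₀) ∨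
      (∃ d : ℝ, 0 < d ∧ HasDerivWithinAt g d (Icc 0 1) 1))
    (hφ : IsYoungFunction φ) {a : ℝ} (ha : 0 < a) {X Y : Ω → ℝ}
    (hX : AEMeasurable X P) (hY : AEMeasurable Y P)
    (hXint : ∫⁻ u, youngAbs φ a (quantile P X (1 - u)) ∂hg.measure < ∞)
    (hYint : ∫⁻ u, youngAbs φ a (quantile P Y (1 - u)) ∂hg.measure < ∞) :
    ∫⁻ u, youngAbs φ (2 * a) (quantile P (X + Y) (1 - u)) ∂hg.measure < ∞ := by
  have hpos : ∀ Z : Ω → ℝ, Antitone fun u => youngAbs φ a (max (quantile P Z (1 - u)) 0) :=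
    fun Z s t hst => monotone_youngAbs_max_zero hφ ha (monotone_quantile Z (by linarith))
  have hneg : ∀ Z : Ω → ℝ, Monotone fun u => youngAbs φ a (min (quantile P Z (1 - u)) 0) :=
    fun Z s t hst => antitone_youngAbs_min_zero hφ ha (monotone_quantile Z (by linarith))
  have hposint : ∀ Z : Ω → ℝ, ∫⁻ u, youngAbs φ a (quantile P Z (1 - u)) ∂hg.measure < ∞ →
      ∫⁻ u, youngAbs φ a (max (quantile P Z (1 - u / 2)) 0) ∂hg.measure < ∞ := by
    intro Z hZ
    refine (hg.lintegral_comp_half_le hconc (hpos Z)).trans_lt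
      (ENNReal.mul_lt_top (by simp) (lt_of_le_of_lt (lintegral_mono fun u => ?_) hZ))
    rw [youngAbs_eq_max_add_min hφ (quantile P Z (1 - u))]
    exact le_self_add
  have hnegint : ∀ Z : Ω → ℝ, ∫⁻ u, youngAbs φ a (quantile P Z (1 - u)) ∂hg.measure < ∞ →
      ∫⁻ u, youngAbs φ a (min (quantile P Z ((1 - u) / 2)) 0) ∂hg.measure < ∞ := by
    intro Z hZ
    have hfin : ∀ u < 1, youngAbs φ a (min (quantile P Z (1 - u)) 0) < ∞ := fun u hu =>
      youngAbs_lt_top (lt_min (bot_lt_quantile Z (sub_pos.mpr hu)) EReal.bot_lt_zero).ne'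
        ((min_le_right _ _).trans_lt EReal.zero_lt_top).ne
    have := hg.lintegral_comp_midpoint_one_lt_top hconc h (hneg Z) hfin
      (lt_of_le_of_lt (lintegral_mono fun u => ?_) hZ)
    -- The identity `1 - (1+u)/2 = (1-u)/2` matches the two arguments.
    · convert this using 7
      ring
    · rw [youngAbs_eq_max_add_min hφ (quantile P Z (1 - u))]
      exact le_add_self
  have hposm : ∀ Z : Ω → ℝ,
      Measurable fun u : ℝ => youngAbs φ a (max (quantile P Z (1 - u / 2)) 0) :=
    fun Z => (hpos Z).measurable.comp (measurable_id.div_const 2)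
  have hnegm : ∀ Z : Ω → ℝ,
      Measurable fun u : ℝ => youngAbs φ a (min (quantile P Z ((1 - u) / 2)) 0) :=
    fun Z => Monotone.measurable fun s t hst =>
      antitone_youngAbs_min_zero hφ ha (monotone_quantile Z (by linarith))
  calc ∫⁻ u, youngAbs φ (2 * a) (quantile P (X + Y) (1 - u)) ∂hg.measure
      ≤ ∫⁻ u, ((youngAbs φ a (max (quantile P X (1 - u / 2)) 0)
            + youngAbs φ a (max (quantile P Y (1 - u / 2)) 0))
          + (youngAbs φ a (min (quantile P X ((1 - u) / 2)) 0)
            + youngAbs φ a (min (quantile P Y ((1 - u) / 2)) 0))) ∂hg.measure := by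
        refine lintegral_mono fun u => ?_
        rw [youngAbs_eq_max_add_min hφ]
        exact add_le_add (youngAbs_max_quantile_add_le hφ ha hX hY u)
          (youngAbs_min_quantile_add_le hφ ha hX hY (1 - u))
    _ < ∞ := by
        rw [lintegral_add_left (by fun_prop), lintegral_add_left (hposm X),
          lintegral_add_left (hnegm X)]
        exact ENNReal.add_lt_top.mpr
          ⟨ENNReal.add_lt_top.mpr ⟨hposint X hXint, hposint Y hYint⟩,
            ENNReal.add_lt_top.mpr ⟨hnegint X hXint, hnegint Y hYint⟩⟩

lemma add_mem_distortedOrlicz (hconc : ConcaveOn ℝ (Icc 0 1) g)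
    (h : (∃ u₀ ∈ Ico (0 : ℝ) 1, ∀ u ∈ Icc u₀ 1, g u = g u₀) ∨
      (∃ d : ℝ, 0 < d ∧ HasDerivWithinAt g d (Icc 0 1) 1))
    (hφ : IsYoungFunction φ) {X Y : Ω →ₘ[P] ℝ} (hX : X ∈ distortedOrlicz P hg φ)
    (hY : Y ∈ distortedOrlicz P hg φ) : X + Y ∈ distortedOrlicz P hg φ := by
  obtain ⟨a, ha, hXint⟩ := (mem_distortedOrlicz_iff hg (ae_eq_refl _)).mp hX
  obtain ⟨b, hb, hYint⟩ := (mem_distortedOrlicz_iff hg (ae_eq_refl _)).mp hY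
  have hab : 0 < max a b := lt_max_of_lt_left ha
  refine (mem_distortedOrlicz_iff hg (AEEqFun.coeFn_add X Y)).mpr
    ⟨2 * max a b, by positivity, ?_⟩
  exact lintegral_youngAbs_quantile_add_lt_top hg hconc h hφ hab X.aemeasurable Y.aemeasurable
    ((lintegral_mono fun u => youngAbs_anti_scale hφ ha (le_max_left a b) _).trans_lt hXint)
    ((lintegral_mono fun u => youngAbs_anti_scale hφ hb (le_max_right a b) _).trans_lt hYint)

lemma zero_mem_distortedOrlicz (hφ : IsYoungFunction φ) :
    (0 : Ω →ₘ[P] ℝ) ∈ distortedOrlicz P hg φ := by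
  refine (mem_distortedOrlicz_iff hg AEEqFun.coeFn_zero).mpr ⟨1, one_pos, ?_⟩
  have hcdf : ∀ x : ℝ, cdf (P.map (0 : Ω → ℝ)) x = if 0 ≤ x then 1 else 0 := by
    intro x
    rw [cdf_map_eq (X := 0) aemeasurable_zero]
    split_ifs with hx <;> simp [hx]
  have hquant : ∀ u ∈ Ico (0 : ℝ) 1, quantile P (0 : Ω → ℝ) (1 - u) = 0 := by
    intro u hu
    refine le_antisymm ?_ ?_
    · rw [← EReal.coe_zero, quantile_le_coe_iff, hcdf, if_pos le_rfl]
      linarith [hu.1]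
    · refine EReal.ge_of_forall_gt_iff_ge.mp fun z hz => ((coe_lt_quantile_iff _ _ _).mpr ?_).le
      rw [hcdf, if_neg (not_le.mpr (by exact_mod_cast hz))]
      linarith [hu.2]
  have : ∫⁻ u, youngAbs φ 1 (quantile P (0 : Ω → ℝ) (1 - u)) ∂hg.measure = ∫⁻ _, 0 ∂hg.measure := by
    refine lintegral_congr_ae ?_
    filter_upwards [hg.ae_mem_Ico] with u hu
    rw [hquant u hu, youngAbs_zero hφ]
  simp [this]

lemma smul_mem_distortedOrlicz (hφ : IsYoungFunction φ) {c : ℝ} (hc : 0 ≤ c) {X : Ω →ₘ[P] ℝ}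
    (hX : X ∈ distortedOrlicz P hg φ) : c • X ∈ distortedOrlicz P hg φ := by
  -- For `c = 0` the new scale `c * a` would not be positive.
  rcases hc.eq_or_lt with rfl | hc
  · rw [zero_smul]; exact zero_mem_distortedOrlicz hg hφ
  obtain ⟨a, ha, hint⟩ := (mem_distortedOrlicz_iff hg (ae_eq_refl _)).mp hX
  refine (mem_distortedOrlicz_iff hg (Y := fun ω => c * X ω) (AEEqFun.coeFn_smul c X)).mpr
    ⟨c * a, mul_pos hc ha, ?_⟩
  simpa only [quantile_const_mul X.aemeasurable hc, youngAbs_mul hc] using hint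

end DistortedOrlicz

theorem proposition5 {Ω : Type*} [MeasurableSpace Ω] (P : Measure Ω) [IsProbabilityMeasure P]
    (g : ℝ → ℝ) (hg : IsDistortionFunction g) (hconc : ConcaveOn ℝ (Icc 0 1) g)
    (h : (∃ u₀ ∈ Ico (0 : ℝ) 1, ∀ u ∈ Icc u₀ 1, g u = g u₀) ∨
      (∃ d : ℝ, 0 < d ∧ HasDerivWithinAt g d (Icc 0 1) 1))
    (φ : ℝ → ℝ) (hφ : IsYoungFunction φ) :
    ∃ C : PointedCone ℝ (Ω →ₘ[P] ℝ), (C : Set (Ω →ₘ[P] ℝ)) = distortedOrlicz P hg φ :=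
  ⟨{ carrier := distortedOrlicz P hg φ
     add_mem' := add_mem_distortedOrlicz hg hconc h hφ
     zero_mem' := zero_mem_distortedOrlicz hg hφ
     smul_mem' := fun c _ hX => smul_mem_distortedOrlicz hg hφ c.2 hX }, rfl⟩
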